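/- **Model.** Let $T$ be the infinite rooted binary tree whose vertices $v$ carry distinct real keys $\mathrm{val}(v)$, each child having a larger key than its parent. For $n\ge 1$, the problem $\mathsf{SELECT}(n)$ is to output the $n$-th smallest key of $T$. The agent starts at the root, moves along edges of $T$ (to the parent or to either child of the current vertex), and sees the key of a vertex only while it is there. It has $g$ memory cells, each of which can hold one key (initially, say, the key of the root). At each vertex it may compare (for order and equality) any two of the keys available to it, namely those in its $g$ cells and the key of the current vertex; it may copy available keys into its cells; and it then moves to a neighbour, or halts and outputs an available key. No other operations on keys are possible. The agent may use randomness, and its decisions may depend on $n$, on the random choices and on the outcomes of all comparisons so far; storing information other than keys, and local computation, are free of charge (so algorithms for which integers also occupy units of memory are included). Its running time is the number of edge traversals. A randomized algorithm with at most $g$ units of storage solves $\mathsf{SELECT}(n)$ if on every such labelled tree $T$, fixed before the execution, it halts with probability $1$ and outputs the $n$-th smallest key with probability $1$. **Theorem.** The time complexity of $\mathsf{SELECT}(n)$ with at most $g$ units of storage is $\Omega(n\log_{g+1} n)$. That is, there is an absolute constant $C>0$ such that for all integers $n\ge 1$ and $g\ge 1$ and every randomized algorithm with at most $g$ units of storage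 that solves $\mathsf{SELECT}(n)$, there is a labelled tree $T$ on which its expected running time is at least $C\, n\log_{g+1} n$. -/

import Mathlib

open MeasureTheory
open scoped ENNReal

noncomputable section

namespace ExplorableHeap

/-- A labelled infinite binary heap.  A vertex is the list of left/right turns leading to it from
the root, the latest turn first: `[]` is the root, `b :: v` are the two children of `v`, and the
parent of `v ≠ []` is `v.tail`.  Labels are distinct and increase from parent to child. -/
structure HeapTree where
  val : List Bool → ℝ
  injective : Function.Injective val
  lt_child : ∀ (v : List Bool) (b : Bool), val v < val (b :: v)

/-- `x` is the `n`-th smallest value of the tree (for `1 ≤ n`). -/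
def HeapTree.IsNthSmallest (T : HeapTree) (n : ℕ) (x : ℝ) : Prop :=
  x ∈ Set.range T.val ∧ {v : List Bool | T.val v ≤ x}.encard = n

/-- The places holding a key that an agent with `g` memory cells has access to:
`none` is the vertex at which the agent resides, `some i` is the `i`-th memory cell. -/
abbrev Source (g : ℕ) : Type := Option (Fin g)

/-- The outcomes of all comparisons between two accessible keys. -/
abbrev Comparisons (g : ℕ) : Type := Source g → Source g → Ordering

/-- The neighbour the agent moves to. -/
inductive Direction : Type
  | parent
  | child (b : Bool)

/-- The endpoint of a move.  A move to the parent leaves the agent at the root if it is there. -/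
def Direction.apply : Direction → List Bool → List Bool
  | .parent, v => v.tail
  | .child b, v => b :: v

/-- What an agent does at a vertex: either overwrite every cell `i` by a copy of the key found at
`copy i` (before the update), pass to the control state `s` and move in direction `d`;
or halt and output the key found at `out`. -/
inductive Decision (g : ℕ) (Control : Type) : Type
  | move (d : Direction) (copy : Fin g → Source g) (s : Control)
  | halt (out : Source g)

/-- A randomized comparison-based algorithm with `g` memory cells for keys.  It has a random seed,
which stands for all its random choices, and a control state, which stands for everything it
remembers apart from keys (integers, random bits, its position, ...); neither is charged.
A decision depends on the keys only through the outcomes of comparisons between the keys in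
the `g` cells and the key of the current vertex. -/
structure RandomizedAlgorithm (g : ℕ) where
  Seed : Type
  [measurableSpaceSeed : MeasurableSpace Seed]
  law : Measure Seed
  [isProbabilityMeasure_law : IsProbabilityMeasure law]
  Control : Type
  [countable_control : Countable Control]
  start : Control
  next : Seed → Control → Comparisons g → Decision g Control
  measurable_next : ∀ (s : Control) (o : Comparisons g) (d : Decision g Control),
    MeasurableSet {ω : Seed | next ω s o = d}

attribute [instance] RandomizedAlgorithm.measurableSpaceSeed
  RandomizedAlgorithm.isProbabilityMeasure_law RandomizedAlgorithm.countable_control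

/-- A configuration of a running agent. -/
structure Config (g : ℕ) (Control : Type) where
  node : List Bool
  cells : Fin g → ℝ
  control : Control

/-- The key found at an accessible place. -/
def Config.read {g : ℕ} {Control : Type} (T : HeapTree) (c : Config g Control) : Source g → ℝ
  | none => T.val c.node
  | some i => c.cells i

/-- The outcomes of the comparisons available in a configuration. -/
def Config.comparisons {g : ℕ} {Control : Type} (T : HeapTree) (c : Config g Control) :
    Comparisons g :=
  fun a b => cmp (c.read T a) (c.read T b)

namespace RandomizedAlgorithm

variable {g : ℕ}

/-- The initial configuration: the agent is at the root, whose key is in all cells. -/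
def initial (A : RandomizedAlgorithm g) (T : HeapTree) : Config g A.Control :=
  ⟨[], fun _ => T.val [], A.start⟩

/-- One step; `Sum.inl c` is a running agent, `Sum.inr x` an agent that halted with output `x`. -/
def step (A : RandomizedAlgorithm g) (T : HeapTree) (ω : A.Seed) :
    Config g A.Control ⊕ ℝ → Config g A.Control ⊕ ℝ
  | .inr x => .inr x
  | .inl c =>
    match A.next ω c.control (c.comparisons T) with
    | .halt out => .inr (c.read T out)
    | .move d copy s => .inl ⟨d.apply c.node, fun i => c.read T (copy i), s⟩

/-- The situation after `t` steps with seed `ω` on the tree `T`. -/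
def run (A : RandomizedAlgorithm g) (T : HeapTree) (ω : A.Seed) (t : ℕ) :
    Config g A.Control ⊕ ℝ :=
  (A.step T ω)^[t] (.inl (A.initial T))

/-- With seed `ω`, the algorithm halts on `T` with output `x`. -/
def Outputs (A : RandomizedAlgorithm g) (T : HeapTree) (ω : A.Seed) (x : ℝ) : Prop :=
  ∃ t : ℕ, A.run T ω t = .inr x

/-- The agent traverses an edge of the tree in the step from time `t` to time `t + 1`. -/
def Traverses (A : RandomizedAlgorithm g) (T : HeapTree) (ω : A.Seed) (t : ℕ) : Prop :=
  ∃ c c' : Config g A.Control,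
    A.run T ω t = .inl c ∧ A.run T ω (t + 1) = .inl c' ∧ c'.node ≠ c.node

open Classical in
/-- The running time: the number of edge traversals. -/
def travelCost (A : RandomizedAlgorithm g) (T : HeapTree) (ω : A.Seed) : ℝ≥0∞ :=
  ∑' t : ℕ, if A.Traverses T ω t then 1 else 0

/-- The expected running time on the tree `T`. -/
def expectedCost (A : RandomizedAlgorithm g) (T : HeapTree) : ℝ≥0∞ :=
  ∫⁻ ω, A.travelCost T ω ∂A.law

/-- The algorithm solves `SELECT(n)`: on every tree, it halts almost surely and outputs the
`n`-th smallest value. -/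
def SolvesSelect (A : RandomizedAlgorithm g) (n : ℕ) : Prop :=
  ∀ T : HeapTree, ∀ᵐ ω ∂A.law, ∃ x : ℝ, A.Outputs T ω x ∧ T.IsNthSmallest n x

end RandomizedAlgorithm

end ExplorableHeap

end

/-! In the hard trees all small keys lie on the two extreme paths. Beyond a depth of at least `R`
(about `n / 4`), each path has `B ^ L` further vertices, indexed in opposite directions along the
two paths. A hidden parameter `K < B ^ L` decides how the two sides interleave, and the answer is
always the vertex of index `K` on side `true`. Two keys of one side compare alike for every `K`.
Indices `i` and `j` of opposite sides compare by whether `s(i) + s(j) ≤ 0`, where `s` is the signed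
ultrametric distance to `K` in the hierarchy of `B`-adic blocks. The farther index dominates the
sum, so a comparison can tell apart parameters of one block only if both indices lie in that block
(`signedLevel_add_nonpos_congr`, `hardTree_val_lt_congr`).

To locate `K` within a block, the agent must therefore bring together keys of that block from both
sides: either a cell already holds one, or it crosses between the sides, a walk of length `2 * R`.
The at most `g ≤ B / 2` keys carried across meet at most half of the `B` sub-blocks, so for most `K`
a new crossing is needed one level further down.

`sum_cost_lower_bound` turns this into an induction over blocks for each fixed seed, with a
potential that credits `2 * R` for every useful cell and the part of a crossing already walked.
Averaging over `K` and over the seed yields a tree of expected cost at least `R` times the number of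
levels minus one. Taking `B = (g + 1) ^ 2` makes this of order `n * log_{g+1} n`. If the logarithm
is bounded, the depth of the answer in `pathTree` suffices. -/

namespace ExplorableHeap

/-! ### Building labelled heaps from integer levels -/

/-- The position of a vertex in the breadth-first numbering of the binary tree. -/
def heapIndex : List Bool → ℕ
  | [] => 1
  | b :: v => 2 * heapIndex v + b.toNat

lemma heapIndex_pos (v : List Bool) : 0 < heapIndex v := by
  induction v with
  | nil => simp [heapIndex]
  | cons b v ih => simp only [heapIndex]; omega

lemma heapIndex_injective : Function.Injective heapIndex := by
  intro v
  induction v with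
  | nil =>
    rintro (_ | ⟨b, w⟩) h
    · rfl
    · have := heapIndex_pos w
      simp only [heapIndex] at h
      omega
  | cons b v ih =>
    rintro (_ | ⟨c, w⟩) h
    · have := heapIndex_pos v
      simp only [heapIndex] at h
      omega
    · simp only [heapIndex] at h
      have hb : heapIndex v = heapIndex w ∧ b = c := by
        cases b <;> cases c <;> simp at h ⊢ <;> omega
      rw [ih hb.1, hb.2]

/-- An injective labelling of the vertices by numbers in `[0, 1)` that increases from parent to
child. -/
noncomputable def heapOffset (v : List Bool) : ℝ := 1 - 1 / (heapIndex v : ℝ)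

lemma heapOffset_lt_iff (v w : List Bool) :
    heapOffset v < heapOffset w ↔ heapIndex v < heapIndex w := by
  have hv : (0 : ℝ) < heapIndex v := by exact_mod_cast heapIndex_pos v
  have hw : (0 : ℝ) < heapIndex w := by exact_mod_cast heapIndex_pos w
  rw [heapOffset, heapOffset, sub_lt_sub_iff_left, one_div_lt_one_div hw hv, Nat.cast_lt]

lemma heapOffset_nonneg (v : List Bool) : 0 ≤ heapOffset v := by
  have hv : (1 : ℝ) ≤ heapIndex v := by exact_mod_cast heapIndex_pos v
  rw [heapOffset, sub_nonneg, div_le_one (by linarith)]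
  exact hv

lemma heapOffset_lt_one (v : List Bool) : heapOffset v < 1 := by
  have hv : (0 : ℝ) < heapIndex v := by exact_mod_cast heapIndex_pos v
  have : 0 < 1 / (heapIndex v : ℝ) := by positivity
  rw [heapOffset]
  linarith

lemma int_add_lt_int_add_iff {a b : ℤ} {x y : ℝ} (hx : 0 ≤ x) (hx1 : x < 1) (hy : 0 ≤ y)
    (hy1 : y < 1) : (a : ℝ) + x < b + y ↔ a < b ∨ a = b ∧ x < y := by
  rcases lt_trichotomy a b with h | h | h
  · have : (a : ℝ) + 1 ≤ b := by exact_mod_cast h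
    simp only [h, true_or, iff_true]
    linarith
  · subst h
    simp
  · have : (b : ℝ) + 1 ≤ a := by exact_mod_cast h
    simp only [h.not_gt, h.ne', false_and, or_self, iff_false, not_lt]
    linarith

/-- The labelled heap whose values have prescribed integer parts. -/
noncomputable def HeapTree.ofLevel (base : List Bool → ℤ)
    (h : ∀ v b, base v ≤ base (b :: v)) : HeapTree where
  val v := base v + heapOffset v
  injective := by
    intro v w hvw
    have h1 := (int_add_lt_int_add_iff (a := base v) (b := base w) (heapOffset_nonneg v)
      (heapOffset_lt_one v) (heapOffset_nonneg w) (heapOffset_lt_one w)).not.1 hvw.not_lt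
    have h2 := (int_add_lt_int_add_iff (a := base w) (b := base v) (heapOffset_nonneg w)
      (heapOffset_lt_one w) (heapOffset_nonneg v) (heapOffset_lt_one v)).not.1 hvw.not_gt
    rw [heapOffset_lt_iff] at h1 h2
    apply heapIndex_injective
    omega
  lt_child v b := by
    rw [int_add_lt_int_add_iff (heapOffset_nonneg v)
      (heapOffset_lt_one v) (heapOffset_nonneg _) (heapOffset_lt_one _), heapOffset_lt_iff]
    have := heapIndex_pos v
    have := h v b
    simp only [heapIndex]
    omega

lemma HeapTree.ofLevel_val_lt_iff {base : List Bool → ℤ} {h : ∀ v b, base v ≤ base (b :: v)}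
    (v w : List Bool) : (HeapTree.ofLevel base h).val v < (HeapTree.ofLevel base h).val w ↔
      base v < base w ∨ base v = base w ∧ heapIndex v < heapIndex w := by
  rw [← heapOffset_lt_iff]
  exact int_add_lt_int_add_iff (heapOffset_nonneg v) (heapOffset_lt_one v) (heapOffset_nonneg w)
    (heapOffset_lt_one w)

lemma HeapTree.val_replicate_strictMono (T : HeapTree) (b : Bool) :
    StrictMono fun d => T.val (List.replicate d b) :=
  strictMono_nat_of_lt_succ fun d => by
    rw [List.replicate_succ]
    exact T.lt_child _ _

lemma HeapTree.IsNthSmallest.unique {T : HeapTree} {n : ℕ} {x y : ℝ}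
    (hx : T.IsNthSmallest n x) (hy : T.IsNthSmallest n y) : x = y := by
  wlog h : x < y generalizing x y
  · rcases lt_trichotomy x y with h1 | h1 | h1
    · exact (h h1).elim
    · exact h1
    · exact (this hy hx h1).symm
  exfalso
  obtain ⟨w, rfl⟩ := hy.1
  have hss : {v | T.val v ≤ x} ⊂ {v | T.val v ≤ T.val w} := by
    refine ⟨fun v hv => le_trans hv h.le, fun hs => ?_⟩
    exact absurd (hs (le_refl (T.val w))) (not_le.2 h)
  have hfin : {v | T.val v ≤ x}.Finite := Set.finite_of_encard_eq_coe hx.2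
  have := hfin.encard_lt_encard hss
  rw [hx.2, hy.2] at this
  exact lt_irrefl _ this

/-! ### Levels of an ultrametric on the natural numbers -/

/-- The number of `m < L` for which `i` and `K` lie in distinct blocks of length `B ^ m`. -/
def sepLevel (B L K i : ℕ) : ℕ := ((Finset.range L).filter fun m => i / B ^ m ≠ K / B ^ m).card

lemma div_pow_eq_of_le {B i K m m' : ℕ} (h : m ≤ m') (hm : i / B ^ m = K / B ^ m) :
    i / B ^ m' = K / B ^ m' := by
  rw [← Nat.add_sub_cancel' h, pow_add, ← Nat.div_div_eq_div_mul, hm, Nat.div_div_eq_div_mul]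

lemma sepLevel_le (B L K i : ℕ) : sepLevel B L K i ≤ L := by
  simpa [sepLevel] using Finset.card_filter_le (Finset.range L) fun m => i / B ^ m ≠ K / B ^ m

lemma sepLevel_self (B L K : ℕ) : sepLevel B L K K = 0 := by simp [sepLevel]

lemma sepLevel_le_of_div_eq {B L K i m : ℕ} (h : i / B ^ m = K / B ^ m) :
    sepLevel B L K i ≤ m := by
  have : ((Finset.range L).filter fun m => i / B ^ m ≠ K / B ^ m) ⊆ Finset.range m := by
    intro m' hm'
    simp only [Finset.mem_filter, Finset.mem_range] at hm' ⊢
    by_contra hlt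
    exact hm'.2 (div_pow_eq_of_le (not_lt.1 hlt) h)
  simpa [sepLevel] using Finset.card_le_card this

lemma lt_sepLevel_of_div_ne {B L K i m : ℕ} (hm : m < L) (h : i / B ^ m ≠ K / B ^ m) :
    m < sepLevel B L K i := by
  have : Finset.range (m + 1) ⊆ (Finset.range L).filter fun m => i / B ^ m ≠ K / B ^ m := by
    intro m' hm'
    simp only [Finset.mem_filter, Finset.mem_range] at hm' ⊢
    exact ⟨by omega, fun h' => h (div_pow_eq_of_le (by omega) h')⟩
  simpa [sepLevel] using Finset.card_le_card this

/-- The isosceles property of an ultrametric: `K` and `K'` are closer to each other than to `j`. -/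
lemma sepLevel_congr {B L K K' j m : ℕ} (hK : K / B ^ m = K' / B ^ m)
    (hj : j / B ^ m ≠ K / B ^ m) : sepLevel B L K j = sepLevel B L K' j := by
  unfold sepLevel
  congr 1
  apply Finset.filter_congr
  intro m' _
  rcases le_total m m' with h | h
  · rw [div_pow_eq_of_le h hK]
  · exact iff_of_true (fun h' => hj (div_pow_eq_of_le h h'))
      fun h' => hj ((div_pow_eq_of_le h h').trans hK.symm)

lemma sepLevel_anti {B L K i i' : ℕ} (h : i ≤ i') (h' : i' ≤ K) :
    sepLevel B L K i' ≤ sepLevel B L K i := by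
  apply Finset.card_le_card
  apply Finset.monotone_filter_right
  intro m _ hm he
  have h1 := Nat.div_le_div_right (c := B ^ m) h
  have h2 := Nat.div_le_div_right (c := B ^ m) h'
  exact hm (by omega)

lemma sepLevel_mono {B L K i i' : ℕ} (h : K ≤ i) (h' : i ≤ i') :
    sepLevel B L K i ≤ sepLevel B L K i' := by
  apply Finset.card_le_card
  apply Finset.monotone_filter_right
  intro m _ hm he
  have h1 := Nat.div_le_div_right (c := B ^ m) h
  have h2 := Nat.div_le_div_right (c := B ^ m) h'
  exact hm (by omega)

/-- The level of `i` relative to `K`, with a negative sign if `i < K`. -/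
def signedLevel (B L K i : ℕ) : ℤ := if i < K then -sepLevel B L K i else sepLevel B L K i

lemma signedLevel_self (B L K : ℕ) : signedLevel B L K K = 0 := by
  simp [signedLevel, sepLevel_self]

lemma signedLevel_mono (B L K : ℕ) : Monotone (signedLevel B L K) := by
  intro i i' h
  unfold signedLevel
  split_ifs with h1 h2 h2
  · have := sepLevel_anti (B := B) (L := L) h h2.le
    omega
  · omega
  · omega
  · have := sepLevel_mono (B := B) (L := L) (not_lt.1 h1) h
    omega

lemma abs_signedLevel (B L K i : ℕ) : |signedLevel B L K i| = sepLevel B L K i := by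
  unfold signedLevel
  split_ifs <;> simp

lemma signedLevel_nonpos_iff {B L K i : ℕ} (hL : 0 < L) : signedLevel B L K i ≤ 0 ↔ i ≤ K := by
  refine ⟨fun h => ?_, fun h => ?_⟩
  · by_contra hi
    have := lt_sepLevel_of_div_ne (B := B) (K := K) (i := i) hL (by simp; omega)
    rw [signedLevel, if_neg (by omega)] at h
    omega
  · exact signedLevel_self B L K ▸ signedLevel_mono B L K h

lemma lt_iff_lt_of_div_eq {K K' j c : ℕ} (hK : K / c = K' / c) (hj : j / c ≠ K / c) :
    j < K ↔ j < K' := by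
  constructor <;> intro h <;> by_contra h' <;> apply hj
  · have h1 := Nat.div_le_div_right (c := c) h.le
    have h2 := Nat.div_le_div_right (c := c) (not_lt.1 h')
    omega
  · have h1 := Nat.div_le_div_right (c := c) h.le
    have h2 := Nat.div_le_div_right (c := c) (not_lt.1 h')
    omega

lemma signedLevel_congr {B L K K' j m : ℕ} (hK : K / B ^ m = K' / B ^ m)
    (hj : j / B ^ m ≠ K / B ^ m) : signedLevel B L K j = signedLevel B L K' j := by
  simp only [signedLevel, sepLevel_congr (L := L) hK hj, lt_iff_lt_of_div_eq hK hj]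

/-- The level of `j` exceeds `m` and is the same for both parameters. If `i` lies in the block, its
level is at most `m`, so the sign of the sum is that of `j`; otherwise the level of `i` is the same
for both parameters too. -/
lemma signedLevel_add_nonpos_congr {B L K K' i j m : ℕ} (hm : m < L)
    (hK : K / B ^ m = K' / B ^ m) (hj : j / B ^ m ≠ K / B ^ m) :
    signedLevel B L K i + signedLevel B L K j ≤ 0 ↔
      signedLevel B L K' i + signedLevel B L K' j ≤ 0 := by
  rw [← signedLevel_congr hK hj]
  by_cases hi : i / B ^ m = K / B ^ m
  · have h1 := sepLevel_le_of_div_eq (L := L) hi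
    have h2 := sepLevel_le_of_div_eq (L := L) (hi.trans hK)
    have h3 := lt_sepLevel_of_div_ne hm hj
    have e1 := abs_signedLevel B L K i
    have e2 := abs_signedLevel B L K' i
    have e3 := abs_signedLevel B L K j
    rcases abs_cases (signedLevel B L K i) with h4 | h4 <;>
    rcases abs_cases (signedLevel B L K' i) with h5 | h5 <;>
    rcases abs_cases (signedLevel B L K j) with h6 | h6 <;> omega
  · rw [signedLevel_congr hK hi]

/-! ### The family of hard labellings -/

lemma cons_eq_replicate_length_iff {c b : Bool} {v : List Bool} :
    c :: v = List.replicate (c :: v).length b ↔ c = b ∧ v = List.replicate v.length b := by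
  simp [List.replicate_succ]

/-- The index of a vertex `v` if it is one of the `N` vertices of depth exceeding `ρ b` that come
first on the path which always turns to side `b`.  The indices decrease along the path if
`b = true`. -/
def deepIndex (ρ : Bool → ℕ) (N : ℕ) (b : Bool) (v : List Bool) : Option ℕ :=
  if v = List.replicate v.length b ∧ ρ b < v.length ∧ v.length ≤ ρ b + N then
    some (if b then N + ρ b - v.length else v.length - ρ b - 1)
  else none

lemma deepIndex_eq_some_iff {ρ : Bool → ℕ} {N : ℕ} {b : Bool} {v : List Bool} {i : ℕ} :
    deepIndex ρ N b v = some i ↔ v = List.replicate v.length b ∧ ρ b < v.length ∧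
      v.length ≤ ρ b + N ∧ i = if b then N + ρ b - v.length else v.length - ρ b - 1 := by
  unfold deepIndex
  by_cases h : v = List.replicate v.length b ∧ ρ b < v.length ∧ v.length ≤ ρ b + N
  · rw [if_pos h, Option.some.injEq]
    tauto
  · rw [if_neg h]
    simp only [reduceCtorEq, false_iff]
    tauto

lemma deepIndex_lt {ρ : Bool → ℕ} {N : ℕ} {b : Bool} {v : List Bool} {i : ℕ}
    (h : deepIndex ρ N b v = some i) : i < N := by
  obtain ⟨-, h1, h2, rfl⟩ := deepIndex_eq_some_iff.1 h
  split_ifs <;> omega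

lemma deepIndex_not_eq_none {ρ : Bool → ℕ} {N : ℕ} {b : Bool} {v : List Bool} {i : ℕ}
    (h : deepIndex ρ N b v = some i) : deepIndex ρ N (!b) v = none := by
  rw [Option.eq_none_iff_forall_ne_some]
  intro j hj
  obtain ⟨h1, h2, -⟩ := deepIndex_eq_some_iff.1 h
  obtain ⟨h3, -⟩ := deepIndex_eq_some_iff.1 hj
  cases v with
  | nil => simp at h2
  | cons c v =>
    rw [cons_eq_replicate_length_iff] at h1 h3
    have := h1.1.symm.trans h3.1
    simp at this

/-- The level of a vertex which is low near the root along the two extreme paths, and high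
elsewhere. -/
def fixedLevel (ρ : Bool → ℕ) (L : ℕ) (v : List Bool) : ℤ :=
  if ∃ b, v = List.replicate v.length b ∧ v.length ≤ ρ b then -(2 * L + 2) else 2 * L + 2

/-- The level of the vertex with index `i` on side `b`. -/
def deepLevel (B L K : ℕ) (b : Bool) (i : ℕ) : ℤ :=
  if b then 1 - 2 * signedLevel B L K i else 2 * signedLevel B L K i

lemma deepLevel_bounds (B L K : ℕ) (b : Bool) (i : ℕ) :
    -(2 * L + 2) < deepLevel B L K b i ∧ deepLevel B L K b i < 2 * L + 2 := by
  have h := abs_signedLevel B L K i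
  have h' := sepLevel_le B L K i
  unfold deepLevel
  rcases abs_cases (signedLevel B L K i) with h1 | h1 <;> split_ifs <;> omega

/-- The levels of the hard labelling with parameter `K`. -/
def hardLevel (ρ : Bool → ℕ) (B L K : ℕ) (v : List Bool) : ℤ :=
  match deepIndex ρ (B ^ L) false v with
  | some i => deepLevel B L K false i
  | none => match deepIndex ρ (B ^ L) true v with
    | some i => deepLevel B L K true i
    | none => fixedLevel ρ L v

lemma hardLevel_of_deepIndex {ρ : Bool → ℕ} {B L K i : ℕ} {b : Bool} {v : List Bool}
    (h : deepIndex ρ (B ^ L) b v = some i) : hardLevel ρ B L K v = deepLevel B L K b i := by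
  cases b
  · simp [hardLevel, h]
  · simp [hardLevel, h, show deepIndex ρ (B ^ L) false v = none from deepIndex_not_eq_none h]

lemma hardLevel_of_forall {ρ : Bool → ℕ} {B L K : ℕ} {v : List Bool}
    (h : ∀ b, deepIndex ρ (B ^ L) b v = none) : hardLevel ρ B L K v = fixedLevel ρ L v := by
  simp [hardLevel, h]

lemma fixedLevel_eq_or (ρ : Bool → ℕ) (L : ℕ) (v : List Bool) :
    fixedLevel ρ L v = -(2 * L + 2) ∨ fixedLevel ρ L v = 2 * L + 2 := by
  unfold fixedLevel
  split_ifs <;> simp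

lemma deepIndex_cases (ρ : Bool → ℕ) (N : ℕ) (v : List Bool) :
    (∀ b, deepIndex ρ N b v = none) ∨ ∃ b i, deepIndex ρ N b v = some i := by
  by_cases h : ∃ b i, deepIndex ρ N b v = some i
  · exact Or.inr h
  · push Not at h
    exact Or.inl fun b => Option.eq_none_iff_forall_ne_some.2 (h b)

lemma hardLevel_bounds (ρ : Bool → ℕ) (B L K : ℕ) (v : List Bool) :
    -(2 * L + 2) ≤ hardLevel ρ B L K v ∧ hardLevel ρ B L K v ≤ 2 * L + 2 := by
  rcases deepIndex_cases ρ (B ^ L) v with h | ⟨b, i, h⟩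
  · rw [hardLevel_of_forall h]
    rcases fixedLevel_eq_or ρ L v with h | h <;> omega
  · rw [hardLevel_of_deepIndex h]
    have := deepLevel_bounds B L K b i
    omega

lemma hardLevel_of_short {ρ : Bool → ℕ} {B L K : ℕ} {b : Bool} {v : List Bool}
    (h : v = List.replicate v.length b) (h' : v.length ≤ ρ b) :
    hardLevel ρ B L K v = -(2 * L + 2) := by
  rw [hardLevel_of_forall, fixedLevel, if_pos ⟨b, h, h'⟩]
  intro c
  rw [Option.eq_none_iff_forall_ne_some]
  intro j hj
  obtain ⟨h3, h4, -⟩ := deepIndex_eq_some_iff.1 hj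
  cases v with
  | nil => simp at h4
  | cons d v =>
    rw [cons_eq_replicate_length_iff] at h h3
    rw [← h3.1, h.1] at h4
    simp only [List.length_cons] at h4 h'
    omega

/-- On side `true` indices fall with depth, but `deepLevel` reverses the sign there, so levels rise
along both paths. -/
lemma hardLevel_le_cons (ρ : Bool → ℕ) (B L K : ℕ) (v : List Bool) (c : Bool) :
    hardLevel ρ B L K v ≤ hardLevel ρ B L K (c :: v) := by
  rcases deepIndex_cases ρ (B ^ L) (c :: v) with h | ⟨b, i, h⟩
  · rw [hardLevel_of_forall h, fixedLevel]
    split_ifs with h'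
    · obtain ⟨b, h1, h2⟩ := h'
      rw [cons_eq_replicate_length_iff] at h1
      rw [hardLevel_of_short h1.2 (by simp at h2; omega)]
    · exact (hardLevel_bounds ρ B L K v).2
  · rw [hardLevel_of_deepIndex h]
    obtain ⟨h1, h2, h3, h4⟩ := deepIndex_eq_some_iff.1 h
    rw [cons_eq_replicate_length_iff] at h1
    rw [List.length_cons] at h2 h3 h4
    by_cases hv : v.length ≤ ρ b
    · rw [hardLevel_of_short h1.2 hv]
      exact (deepLevel_bounds B L K b i).1.le
    · rw [hardLevel_of_deepIndex (deepIndex_eq_some_iff.2 ⟨h1.2, not_le.1 hv, by omega, rfl⟩), h4]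
      cases b
      · have := signedLevel_mono B L K
          (show v.length - ρ false - 1 ≤ v.length + 1 - ρ false - 1 by omega)
        simp only [deepLevel, Bool.false_eq_true, if_false]
        omega
      · have := signedLevel_mono B L K
          (show B ^ L + ρ true - (v.length + 1) ≤ B ^ L + ρ true - v.length by omega)
        simp only [deepLevel, if_true]
        omega

/-- The hard labelling with parameter `K`. -/
noncomputable def hardTree (ρ : Bool → ℕ) (B L K : ℕ) : HeapTree :=
  HeapTree.ofLevel (hardLevel ρ B L K) (hardLevel_le_cons ρ B L K)

lemma hardTree_val_lt_iff {ρ : Bool → ℕ} {B L K : ℕ} (v w : List Bool) :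
    (hardTree ρ B L K).val v < (hardTree ρ B L K).val w ↔
      hardLevel ρ B L K v < hardLevel ρ B L K w ∨
        hardLevel ρ B L K v = hardLevel ρ B L K w ∧ heapIndex v < heapIndex w :=
  HeapTree.ofLevel_val_lt_iff v w

/-- Deep levels are even on side `false` and odd on side `true`, so the tie-breaking offsets never
matter between the sides. -/
lemma hardTree_val_lt_iff_of_deep {ρ : Bool → ℕ} {B L K i j : ℕ} {v w : List Bool}
    {b : Bool} (hv : deepIndex ρ (B ^ L) b v = some i) (hw : deepIndex ρ (B ^ L) (!b) w = some j) :
    (hardTree ρ B L K).val v < (hardTree ρ B L K).val w ↔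
      if b then ¬ signedLevel B L K j + signedLevel B L K i ≤ 0
        else signedLevel B L K i + signedLevel B L K j ≤ 0 := by
  rw [hardTree_val_lt_iff, hardLevel_of_deepIndex hv, hardLevel_of_deepIndex hw]
  cases b <;> simp [deepLevel] <;> omega

lemma hardTree_val_lt_iff_of_same_side {ρ : Bool → ℕ} {B L K i j : ℕ} {v w : List Bool}
    {b : Bool} (hv : deepIndex ρ (B ^ L) b v = some i) (hw : deepIndex ρ (B ^ L) b w = some j) :
    (hardTree ρ B L K).val v < (hardTree ρ B L K).val w ↔ v.length < w.length := by
  rw [(deepIndex_eq_some_iff.1 hv).1, (deepIndex_eq_some_iff.1 hw).1, List.length_replicate,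
    List.length_replicate]
  exact ((hardTree ρ B L K).val_replicate_strictMono b).lt_iff_lt

/-- Vertices of side `b`, as well as those of the other side whose index is not in the block
`K / B ^ m`, compare in the same way for all parameters in that block. -/
lemma hardTree_val_lt_congr {ρ : Bool → ℕ} {B L K K' m : ℕ} (hB : 0 < B) (hK : K < B ^ L)
    (hKK' : K / B ^ m = K' / B ^ m) {b : Bool} {v w : List Bool}
    (hv : ∀ j, deepIndex ρ (B ^ L) (!b) v = some j → j / B ^ m ≠ K / B ^ m)
    (hw : ∀ j, deepIndex ρ (B ^ L) (!b) w = some j → j / B ^ m ≠ K / B ^ m) :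
    (hardTree ρ B L K).val v < (hardTree ρ B L K).val w ↔
      (hardTree ρ B L K').val v < (hardTree ρ B L K').val w := by
  -- A block of length `B ^ m` with `m ≥ L` starting at 0 contains all indices, so nothing can lie
  -- outside it.
  have key : ∀ j, j < B ^ L → j / B ^ m ≠ K / B ^ m → m < L := by
    intro j hj hne
    by_contra hm
    have := Nat.pow_le_pow_right hB (not_lt.1 hm)
    rw [Nat.div_eq_of_lt (by omega), Nat.div_eq_of_lt (by omega)] at hne
    exact hne rfl
  rcases deepIndex_cases ρ (B ^ L) v with h | ⟨c, i, h⟩ <;>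
    rcases deepIndex_cases ρ (B ^ L) w with h' | ⟨d, j, h'⟩
  · simp only [hardTree_val_lt_iff, hardLevel_of_forall h, hardLevel_of_forall h']
  · simp only [hardTree_val_lt_iff, hardLevel_of_forall h, hardLevel_of_deepIndex h']
    have h1 := deepLevel_bounds B L K d j
    have h2 := deepLevel_bounds B L K' d j
    rcases fixedLevel_eq_or ρ L v with h3 | h3 <;> omega
  · simp only [hardTree_val_lt_iff, hardLevel_of_forall h', hardLevel_of_deepIndex h]
    have h1 := deepLevel_bounds B L K c i
    have h2 := deepLevel_bounds B L K' c i
    rcases fixedLevel_eq_or ρ L w with h3 | h3 <;> omega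
  · rcases Bool.eq_or_eq_not d c with rfl | rfl
    · rw [hardTree_val_lt_iff_of_same_side h h', hardTree_val_lt_iff_of_same_side h h']
    · rw [hardTree_val_lt_iff_of_deep h h', hardTree_val_lt_iff_of_deep h h']
      have hsep : m < L ∧ (i / B ^ m ≠ K / B ^ m ∨ j / B ^ m ≠ K / B ^ m) := by
        rcases Bool.eq_or_eq_not c b with rfl | rfl
        · exact ⟨key j (deepIndex_lt h') (hw j h'), Or.inr (hw j h')⟩
        · exact ⟨key i (deepIndex_lt h) (hv i h), Or.inl (hv i h)⟩
      have hiff : signedLevel B L K i + signedLevel B L K j ≤ 0 ↔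
          signedLevel B L K' i + signedLevel B L K' j ≤ 0 := by
        rcases hsep.2 with hs | hs
        · rw [add_comm, add_comm (signedLevel B L K' i)]
          exact signedLevel_add_nonpos_congr hsep.1 hKK' hs
        · exact signedLevel_add_nonpos_congr hsep.1 hKK' hs
      cases c <;> simp only [Bool.false_eq_true, if_false, if_true]
      · exact hiff
      · rw [add_comm, add_comm (signedLevel B L K' j), hiff]

/-- The vertex of index `K` on side `true`. -/
def answerVertex (ρ : Bool → ℕ) (N K : ℕ) : List Bool := List.replicate (N + ρ true - K) true

lemma deepIndex_answerVertex {ρ : Bool → ℕ} {N K : ℕ} (hK : K < N) :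
    deepIndex ρ N true (answerVertex ρ N K) = some K := by
  rw [deepIndex_eq_some_iff]
  simp [answerVertex]
  omega

/-- Up to the answer there are the `K + 1` deep vertices of index at most `K` on side `false`, the
`B ^ L - K` of index at least `K` on side `true`, and the `ρ false + ρ true + 1` low vertices
including the root. The total does not depend on `K`. -/
lemma hardTree_isNthSmallest {ρ : Bool → ℕ} {B L K : ℕ} (hL : 0 < L) (hK : K < B ^ L) :
    (hardTree ρ B L K).IsNthSmallest (ρ false + ρ true + B ^ L + 2)
      ((hardTree ρ B L K).val (answerVertex ρ (B ^ L) K)) := by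
  refine ⟨⟨_, rfl⟩, ?_⟩
  have ha := deepIndex_answerVertex (ρ := ρ) hK
  have hla : hardLevel ρ B L K (answerVertex ρ (B ^ L) K) = 1 := by
    rw [hardLevel_of_deepIndex ha, deepLevel, signedLevel_self]
    simp
  set T := hardTree ρ B L K with hT
  have hset : {v : List Bool | T.val v ≤ T.val (answerVertex ρ (B ^ L) K)} =
      (((Finset.range (ρ false + K + 2)).image fun d => List.replicate d false) ∪
        (Finset.Icc 1 (B ^ L + ρ true - K)).image fun d => List.replicate d true :
          Finset (List Bool)) := by
    ext v
    simp only [Set.mem_ofPred_eq, Finset.coe_union, Finset.coe_image, Set.mem_union,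
      Set.mem_image, Finset.mem_coe, Finset.mem_range, Finset.mem_Icc]
    by_cases h1 : v = List.replicate v.length false
    · have hr : (∃ d, d < ρ false + K + 2 ∧ List.replicate d false = v) ∨
          (∃ d, (1 ≤ d ∧ d ≤ B ^ L + ρ true - K) ∧ List.replicate d true = v) ↔
            v.length < ρ false + K + 2 := by
        constructor
        · rintro (⟨d, hd, rfl⟩ | ⟨d, hd, rfl⟩)
          · simpa using hd
          · obtain ⟨d, rfl⟩ := Nat.exists_eq_add_of_le' hd.1
            simp [List.replicate_succ] at h1
        · exact fun h => Or.inl ⟨v.length, h, h1.symm⟩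
      rw [hr, ← not_lt, hardTree_val_lt_iff, hla]
      by_cases h2 : v.length ≤ ρ false
      · rw [hardLevel_of_short h1 h2]
        omega
      by_cases h3 : v.length ≤ ρ false + B ^ L
      · rw [hardLevel_of_deepIndex
          (deepIndex_eq_some_iff.2 ⟨h1, not_le.1 h2, h3, rfl⟩), deepLevel]
        simp only [Bool.false_eq_true, if_false]
        have := signedLevel_nonpos_iff (B := B) (K := K) (i := v.length - ρ false - 1) hL
        omega
      · have hn : hardLevel ρ B L K v = 2 * L + 2 := by
          rw [hardLevel_of_forall, fixedLevel, if_neg]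
          · rintro ⟨b, hb, hb'⟩
            cases v with
            | nil => simp at h2
            | cons c v =>
              rw [cons_eq_replicate_length_iff] at h1 hb
              rw [← hb.1, h1.1] at hb'
              simp only [List.length_cons] at hb' h2 h3
              omega
          · intro b
            rw [Option.eq_none_iff_forall_ne_some]
            intro i hi
            obtain ⟨hb, -, hb', -⟩ := deepIndex_eq_some_iff.1 hi
            cases v with
            | nil => simp at h2
            | cons c v =>
              rw [cons_eq_replicate_length_iff] at h1 hb
              rw [← hb.1, h1.1] at hb'
              simp only [List.length_cons] at hb' h2 h3
              omega
        rw [hn]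
        omega
    by_cases h2 : v = List.replicate v.length true
    · have hr : (∃ d, d < ρ false + K + 2 ∧ List.replicate d false = v) ∨
          (∃ d, (1 ≤ d ∧ d ≤ B ^ L + ρ true - K) ∧ List.replicate d true = v) ↔
            v.length ≤ B ^ L + ρ true - K := by
        constructor
        · rintro (⟨d, hd, rfl⟩ | ⟨d, hd, rfl⟩)
          · simp at h1
          · simpa using hd.2
        · refine fun h => Or.inr ⟨v.length, ⟨?_, h⟩, h2.symm⟩
          rw [Nat.one_le_iff_ne_zero]
          intro h0
          rw [List.length_eq_zero_iff] at h0
          simp [h0] at h1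
      rw [hr, h2, answerVertex, List.length_replicate]
      exact (T.val_replicate_strictMono true).le_iff_le
    · refine iff_of_false ?_ ?_
      · rw [not_le, hardTree_val_lt_iff, hla, hardLevel_of_forall, fixedLevel, if_neg]
        · omega
        · rintro ⟨b, hb, -⟩
          cases b <;> contradiction
        · intro b
          rw [Option.eq_none_iff_forall_ne_some]
          intro i hi
          have := (deepIndex_eq_some_iff.1 hi).1
          cases b <;> contradiction
      · rintro (⟨d, -, rfl⟩ | ⟨d, -, rfl⟩)
        · simp at h1
        · simp at h2
  rw [hset, Set.encard_coe_eq_coe_finsetCard, Finset.card_union_of_disjoint,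
    Finset.card_image_of_injective _ (List.replicate_left_injective _),
    Finset.card_image_of_injective _ (List.replicate_left_injective _)]
  · simp only [Finset.card_range, Nat.card_Icc]
    congr 1
    omega
  · rw [Finset.disjoint_left]
    intro v hv hv'
    simp only [Finset.mem_image, Finset.mem_range, Finset.mem_Icc] at hv hv'
    obtain ⟨d, -, rfl⟩ := hv
    obtain ⟨e, he, he'⟩ := hv'
    obtain ⟨e, rfl⟩ := Nat.exists_eq_add_of_le' he.1
    cases d <;> simp [List.replicate_succ] at he'

/-! ### A labelling with all small keys on a path -/

/-- A labelling in which the `n` smallest keys are found on a path from the root. -/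
noncomputable def pathTree (n : ℕ) : HeapTree :=
  HeapTree.ofLevel (fun v => if v = List.replicate v.length false ∧ v.length < n then 0 else 1) <| by
    intro v b
    split_ifs with h1 h2 h2
    · rfl
    · omega
    · rw [cons_eq_replicate_length_iff, List.length_cons] at h2
      exact (h1 ⟨h2.1.2, by omega⟩).elim
    · rfl

lemma pathTree_isNthSmallest (n : ℕ) :
    (pathTree (n + 1)).IsNthSmallest (n + 1)
      ((pathTree (n + 1)).val (List.replicate n false)) := by
  refine ⟨⟨_, rfl⟩, ?_⟩
  have hset : {v : List Bool | (pathTree (n + 1)).val v ≤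
      (pathTree (n + 1)).val (List.replicate n false)} =
      ((Finset.range (n + 1)).image fun d => List.replicate d false : Finset (List Bool)) := by
    ext v
    simp only [Set.mem_ofPred_eq, Finset.coe_image, Set.mem_image, Finset.mem_coe,
      Finset.mem_range]
    by_cases h1 : v = List.replicate v.length false
    · rw [h1, ((pathTree (n + 1)).val_replicate_strictMono false).le_iff_le, ← Nat.lt_succ_iff]
      exact ⟨fun h => ⟨_, h, rfl⟩, fun ⟨d, hd, he⟩ => by
        rwa [← List.replicate_left_injective _ he]⟩
    · refine iff_of_false ?_ ?_
      · rw [not_le, pathTree, HeapTree.ofLevel_val_lt_iff]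
        simp [h1]
      · rintro ⟨d, -, rfl⟩
        simp at h1
  rw [hset, Set.encard_coe_eq_coe_finsetCard,
    Finset.card_image_of_injective _ (List.replicate_left_injective _), Finset.card_range]

/-! ### Runs in terms of vertices -/

/-- A configuration in which every cell holds a vertex in place of its key. -/
structure VertexConfig (g : ℕ) (Control : Type) where
  node : List Bool
  cells : Fin g → List Bool
  control : Control

namespace VertexConfig

variable {g : ℕ} {Control : Type}

/-- The vertex whose key is found at an accessible place. -/
def place (c : VertexConfig g Control) : Source g → List Bool
  | none => c.node
  | some i => c.cells i

/-- The configuration of keys. -/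
def toConfig (T : HeapTree) (c : VertexConfig g Control) : Config g Control :=
  ⟨c.node, fun i => T.val (c.cells i), c.control⟩

lemma read_toConfig (T : HeapTree) (c : VertexConfig g Control) (a : Source g) :
    (c.toConfig T).read T a = T.val (c.place a) := by
  cases a <;> rfl

instance [Countable Control] : Countable (VertexConfig g Control) :=
  Function.Injective.countable
    (f := fun c : VertexConfig g Control => (c.node, c.cells, c.control)) <| by
      rintro ⟨_, _, _⟩ ⟨_, _, _⟩ h
      simpa using h

end VertexConfig

lemma cmp_congr {α β : Type*} [LinearOrder α] [LinearOrder β] {x y : α} {x' y' : β}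
    (h : x < y ↔ x' < y') (h' : y < x ↔ y' < x') : cmp x y = cmp x' y' := by
  simp only [cmp, cmpUsing, h, h']

namespace RandomizedAlgorithm

variable {g : ℕ} (A : RandomizedAlgorithm g) (T : HeapTree) (ω : A.Seed)

/-- One step of the algorithm in terms of vertices. -/
noncomputable def vertexStep :
    VertexConfig g A.Control ⊕ List Bool → VertexConfig g A.Control ⊕ List Bool
  | .inr v => .inr v
  | .inl c =>
    match A.next ω c.control ((c.toConfig T).comparisons T) with
    | .halt out => .inr (c.place out)
    | .move d copy s => .inl ⟨d.apply c.node, fun i => c.place (copy i), s⟩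

/-- The initial configuration in terms of vertices. -/
def vertexInitial : VertexConfig g A.Control := ⟨[], fun _ => [], A.start⟩

lemma step_map (x : VertexConfig g A.Control ⊕ List Bool) :
    A.step T ω (x.map (VertexConfig.toConfig T) T.val) =
      (A.vertexStep T ω x).map (VertexConfig.toConfig T) T.val := by
  rcases x with c | v
  · simp only [Sum.map_inl, step, vertexStep]
    rw [show (c.toConfig T).control = c.control from rfl]
    rcases A.next ω c.control ((c.toConfig T).comparisons T) with ⟨d, copy, s⟩ | out
    · simp only [VertexConfig.read_toConfig, Sum.map_inl]
      rfl
    · simp only [VertexConfig.read_toConfig, Sum.map_inr]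
  · rfl

/-- Recording vertices in place of keys lets one configuration be shared by runs on different trees.
-/
lemma run_eq_map (t : ℕ) : A.run T ω t =
    ((A.vertexStep T ω)^[t] (.inl A.vertexInitial)).map (VertexConfig.toConfig T) T.val := by
  induction t with
  | zero => rfl
  | succ t ih =>
    rw [Function.iterate_succ_apply', ← step_map, ← ih, run, run, Function.iterate_succ_apply']

lemma vertexStep_iterate_inr (k : ℕ) (v : List Bool) :
    (A.vertexStep T ω)^[k] (.inr v) = .inr v := by
  induction k with
  | zero => rfl
  | succ k ih => rw [Function.iterate_succ_apply, vertexStep, ih]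

/-- The number of edges traversed between two consecutive situations. -/
def edgeCount {Control : Type} : VertexConfig g Control ⊕ List Bool →
    VertexConfig g Control ⊕ List Bool → ℕ
  | .inl c, .inl c' => if c'.node = c.node then 0 else 1
  | _, _ => 0

/-- The number of edges traversed in the next `k` steps. -/
noncomputable def cost : ℕ → VertexConfig g A.Control ⊕ List Bool → ℕ
  | 0, _ => 0
  | k + 1, x => edgeCount x (A.vertexStep T ω x) + cost k (A.vertexStep T ω x)

lemma cost_eq_sum (k : ℕ) (x : VertexConfig g A.Control ⊕ List Bool) :
    A.cost T ω k x = ∑ t ∈ Finset.range k,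
      edgeCount ((A.vertexStep T ω)^[t] x) ((A.vertexStep T ω)^[t + 1] x) := by
  induction k generalizing x with
  | zero => rfl
  | succ k ih =>
    rw [cost, ih, Finset.sum_range_succ', add_comm]
    rfl

open Classical in
lemma traverses_indicator (t : ℕ) : (if A.Traverses T ω t then 1 else 0 : ℝ≥0∞) =
    edgeCount ((A.vertexStep T ω)^[t] (.inl A.vertexInitial))
      ((A.vertexStep T ω)^[t + 1] (.inl A.vertexInitial)) := by
  unfold Traverses
  rw [run_eq_map, run_eq_map]
  rcases (A.vertexStep T ω)^[t] (.inl A.vertexInitial) with c | v <;>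
    rcases (A.vertexStep T ω)^[t + 1] (.inl A.vertexInitial) with c' | v' <;>
    simp [edgeCount, VertexConfig.toConfig]

lemma travelCost_eq_tsum : A.travelCost T ω =
    ∑' t : ℕ, (edgeCount ((A.vertexStep T ω)^[t] (.inl A.vertexInitial))
      ((A.vertexStep T ω)^[t + 1] (.inl A.vertexInitial)) : ℝ≥0∞) := by
  rw [travelCost]
  exact tsum_congr fun t => A.traverses_indicator T ω t

lemma cost_le_travelCost (k : ℕ) :
    (A.cost T ω k (.inl A.vertexInitial) : ℝ≥0∞) ≤ A.travelCost T ω := by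
  rw [travelCost_eq_tsum, cost_eq_sum, Nat.cast_sum]
  exact ENNReal.sum_le_tsum _

/-! ### Measurability of the running time -/

lemma measurableSet_vertexStep (x y : VertexConfig g A.Control ⊕ List Bool) :
    MeasurableSet {ω | A.vertexStep T ω x = y} := by
  rcases x with c | v
  · have : {ω | A.vertexStep T ω (.inl c) = y} =
        (⋃ (out : Source g) (_ : .inr (c.place out) = y),
          {ω | A.next ω c.control ((c.toConfig T).comparisons T) = .halt out}) ∪
        ⋃ (s : A.Control) (copy : Fin g → Source g) (b : Option Bool)
          (_ : .inl ⟨(b.elim Direction.parent Direction.child).apply c.node,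
            fun i => c.place (copy i), s⟩ = y),
          {ω | A.next ω c.control ((c.toConfig T).comparisons T) =
            .move (b.elim Direction.parent Direction.child) copy s} := by
      ext ω
      simp only [Set.mem_ofPred_eq, Set.mem_union, Set.mem_iUnion, exists_prop, vertexStep]
      constructor
      · intro h
        rcases hn : A.next ω c.control ((c.toConfig T).comparisons T) with ⟨d, copy, s⟩ | out
        · rw [hn] at h
          refine Or.inr ⟨s, copy, ?_⟩
          rcases d with _ | b
          · exact ⟨none, h, rfl⟩
          · exact ⟨some b, h, rfl⟩
        · rw [hn] at h
          exact Or.inl ⟨out, h, rfl⟩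
      · rintro (⟨out, h, hn⟩ | ⟨s, copy, b, h, hn⟩) <;> rw [hn] <;> exact h
    rw [this]
    refine MeasurableSet.union ?_ ?_
    · exact MeasurableSet.iUnion fun _ => MeasurableSet.iUnion fun _ => A.measurable_next _ _ _
    · exact MeasurableSet.iUnion fun _ => MeasurableSet.iUnion fun _ => MeasurableSet.iUnion
        fun _ => MeasurableSet.iUnion fun _ => A.measurable_next _ _ _
  · exact MeasurableSet.const (.inr v = y)

lemma measurableSet_vertexStep_iterate (t : ℕ) (x y : VertexConfig g A.Control ⊕ List Bool) :
    MeasurableSet {ω | (A.vertexStep T ω)^[t] x = y} := by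
  induction t generalizing y with
  | zero => exact MeasurableSet.const (x = y)
  | succ t ih =>
    have : {ω | (A.vertexStep T ω)^[t + 1] x = y} =
        ⋃ z, {ω | (A.vertexStep T ω)^[t] x = z} ∩ {ω | A.vertexStep T ω z = y} := by
      ext ω
      simp [Function.iterate_succ_apply']
    rw [this]
    exact MeasurableSet.iUnion fun z => (ih z).inter (A.measurableSet_vertexStep T z y)

/-- Needed to exchange the sum over `K` with the expectation. Countability of the control states
reduces it to single configurations. -/
lemma measurable_travelCost : Measurable (A.travelCost T) := by
  have : A.travelCost T = fun ω => ∑' t : ℕ,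
      (edgeCount ((A.vertexStep T ω)^[t] (.inl A.vertexInitial))
        ((A.vertexStep T ω)^[t + 1] (.inl A.vertexInitial)) : ℝ≥0∞) :=
    funext fun ω => A.travelCost_eq_tsum T ω
  rw [this]
  refine Measurable.tsum fun t => ?_
  let _ : MeasurableSpace (VertexConfig g A.Control ⊕ List Bool) := ⊤
  have hrun : ∀ t, Measurable fun ω => (A.vertexStep T ω)^[t] (.inl A.vertexInitial) :=
    fun t => measurable_to_countable' fun y => A.measurableSet_vertexStep_iterate T t _ y
  have hpair : Measurable fun p : (VertexConfig g A.Control ⊕ List Bool) ×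
      (VertexConfig g A.Control ⊕ List Bool) => (edgeCount p.1 p.2 : ℝ≥0∞) :=
    measurable_from_prod_countable_right fun _ => measurable_from_top
  exact hpair.comp ((hrun t).prodMk (hrun (t + 1)))

/-! ### Output vertices -/

lemma SolvesSelect.ae_exists_vertex {A : RandomizedAlgorithm g} {n : ℕ} (hA : A.SolvesSelect n)
    {T : HeapTree} {v : List Bool} (hv : T.IsNthSmallest n (T.val v)) :
    ∀ᵐ ω ∂A.law, ∃ k, (A.vertexStep T ω)^[k] (.inl A.vertexInitial) = .inr v := by
  filter_upwards [hA T] with ω ⟨x, ⟨t, ht⟩, hx⟩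
  refine ⟨t, ?_⟩
  rw [run_eq_map] at ht
  rcases h : (A.vertexStep T ω)^[t] (.inl A.vertexInitial) with c | w
  · simp [h] at ht
  · rw [h, Sum.map_inr, Sum.inr.injEq] at ht
    rw [T.injective (ht.trans (hx.unique hv))]

/-- A key is obtained only by visiting its vertex, and each traversed edge raises the greatest
available depth by at most one. -/
lemma length_le_add_cost (k D : ℕ) (c : VertexConfig g A.Control) (v : List Bool)
    (hc : ∀ a, (c.place a).length ≤ D)
    (hv : (A.vertexStep T ω)^[k] (.inl c) = .inr v) :
    v.length ≤ D + A.cost T ω k (.inl c) := by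
  induction k generalizing c D with
  | zero => simp at hv
  | succ k ih =>
    rw [Function.iterate_succ_apply] at hv
    rw [cost]
    rcases h : A.vertexStep T ω (.inl c) with c' | w
    · rw [h] at hv
      rw [← add_assoc]
      refine ih _ c' ?_ hv
      rw [vertexStep] at h
      rcases hn : A.next ω c.control ((c.toConfig T).comparisons T) with ⟨d, copy, s⟩ | out
      · rw [hn] at h
        obtain rfl := Sum.inl.inj h
        rintro (_ | i)
        · have h0 := hc none
          simp only [VertexConfig.place, edgeCount] at h0 ⊢
          split_ifs with he
          · rw [he]
            exact h0
          · rcases d with _ | b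
            · simp only [Direction.apply, List.length_tail]
              omega
            · simp only [Direction.apply, List.length_cons]
              omega
        · exact (hc (copy i)).trans (Nat.le_add_right _ _)
      · simp [hn] at h
    · rw [h, vertexStep_iterate_inr] at hv
      obtain rfl := Sum.inr.inj hv
      rw [vertexStep] at h
      rcases hn : A.next ω c.control ((c.toConfig T).comparisons T) with ⟨d, copy, s⟩ | out
      · simp [hn] at h
      · rw [hn] at h
        obtain rfl := Sum.inr.inj h
        exact (hc out).trans (Nat.le_add_right _ _)

lemma SolvesSelect.le_expectedCost_pathTree {A : RandomizedAlgorithm g} {n : ℕ}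
    (hA : A.SolvesSelect (n + 1)) : (n : ℝ≥0∞) ≤ A.expectedCost (pathTree (n + 1)) := by
  calc (n : ℝ≥0∞) = ∫⁻ _, (n : ℝ≥0∞) ∂A.law := by simp
    _ ≤ A.expectedCost (pathTree (n + 1)) := by
      refine lintegral_mono_ae ?_
      filter_upwards [hA.ae_exists_vertex (pathTree_isNthSmallest n)] with ω ⟨k, hk⟩
      refine le_trans ?_ (A.cost_le_travelCost _ _ k)
      have := A.length_le_add_cost _ ω k 0 _ _ (by rintro (_ | i) <;> rfl) hk
      rw [List.length_replicate, zero_add] at this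
      exact_mod_cast this

end RandomizedAlgorithm

/-! ### Distance between the two sides -/

/-- The depth at which the path to a vertex leaves the path which always turns to the same side as
its first edge; it is counted negatively if that side is not `b`. -/
def signedDepth (b : Bool) : List Bool → ℤ
  | [] => 0
  | c :: v =>
    if v = List.replicate v.length c then (if c = b then (v.length + 1 : ℤ) else -(v.length + 1 : ℤ))
    else signedDepth b v

lemma signedDepth_replicate (b c : Bool) (d : ℕ) :
    signedDepth b (List.replicate d c) = if c = b then (d : ℤ) else -(d : ℤ) := by
  cases d with
  | zero => simp [signedDepth]
  | succ d => simp [List.replicate_succ, signedDepth]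

lemma signedDepth_not (b : Bool) (v : List Bool) : signedDepth (!b) v = -signedDepth b v := by
  induction v with
  | nil => simp [signedDepth]
  | cons c v ih =>
    simp only [signedDepth, ih]
    cases b <;> cases c <;> simp <;> split_ifs <;> omega

/-- `signedDepth` retracts the tree onto the line formed by the two extreme paths; leaving that line
does not change it. -/
lemma abs_signedDepth_cons_sub (b c : Bool) (v : List Bool) :
    |signedDepth b (c :: v) - signedDepth b v| ≤ 1 := by
  rw [signedDepth]
  split_ifs with h1 h2
  · rw [h1, signedDepth_replicate, if_pos h2]
    simp
  · rw [h1, signedDepth_replicate, if_neg h2]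
    simp
  · simp

lemma abs_signedDepth_apply_sub (b : Bool) (d : Direction) (v : List Bool) :
    |signedDepth b (d.apply v) - signedDepth b v| ≤ if d.apply v = v then 0 else 1 := by
  split_ifs with h
  · simp [h]
  · rcases d with _ | c
    · cases v with
      | nil => simp [Direction.apply] at h
      | cons c v =>
        rw [abs_sub_comm]
        exact abs_signedDepth_cons_sub b c v
    · exact abs_signedDepth_cons_sub b c v

/-- An upper bound on the distance travelled from depth `R` of side `b` on the way to the other
side. -/
def sideDistance (R : ℕ) (b : Bool) (v : List Bool) : ℤ := max 0 (R - signedDepth b v)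

lemma sideDistance_nonneg (R : ℕ) (b : Bool) (v : List Bool) : 0 ≤ sideDistance R b v :=
  le_max_left _ _

lemma sideDistance_apply_le (R : ℕ) (b : Bool) (d : Direction) (v : List Bool) :
    sideDistance R b (d.apply v) ≤ sideDistance R b v + if d.apply v = v then 0 else 1 := by
  have h := abs_le.1 (abs_signedDepth_apply_sub b d v)
  unfold sideDistance
  split_ifs at h ⊢ <;> omega

lemma signedDepth_of_deepIndex {ρ : Bool → ℕ} {N i : ℕ} {b : Bool} {v : List Bool}
    (h : deepIndex ρ N b v = some i) : (ρ b : ℤ) < signedDepth b v := by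
  obtain ⟨h1, h2, -⟩ := deepIndex_eq_some_iff.1 h
  rw [h1, signedDepth_replicate, if_pos rfl]
  exact_mod_cast h2

/-! ### Blocks -/

lemma sum_Ico_blocks {M : Type*} [AddCommMonoid M] (f : ℕ → M) (c : ℕ) {a b : ℕ} (hab : a ≤ b) :
    ∑ q ∈ Finset.Ico a b, ∑ K ∈ Finset.Ico (q * c) ((q + 1) * c), f K =
      ∑ K ∈ Finset.Ico (a * c) (b * c), f K := by
  induction b, hab using Nat.le_induction with
  | base => simp
  | succ b hb ih =>
    rw [Finset.sum_Ico_succ_top hb, ih, Finset.sum_Ico_consecutive]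
    · exact Nat.mul_le_mul_right c hb
    · exact Nat.mul_le_mul_right c (Nat.le_succ b)

lemma div_eq_of_mem_Ico {K q c : ℕ} (h : K ∈ Finset.Ico (q * c) ((q + 1) * c)) : K / c = q := by
  rw [Finset.mem_Ico] at h
  exact Nat.div_eq_of_lt_le h.1 h.2

open Classical in
/-- The number of cells which hold vertices of the side other than `b` with indices in the block
`[q * B ^ m, (q + 1) * B ^ m)`. -/
noncomputable def trackedCells {g : ℕ} (ρ : Bool → ℕ) (N B m q : ℕ) (b : Bool)
    (cells : Fin g → List Bool) : ℕ :=
  (Finset.univ.filter fun i => ∃ j, deepIndex ρ N (!b) (cells i) = some j ∧ j / B ^ m = q).card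

/-- A cell holds a single vertex, so it is counted for at most one sub-block. -/
lemma sum_trackedCells_le {g : ℕ} (ρ : Bool → ℕ) (N B m q : ℕ) (b : Bool)
    (cells : Fin g → List Bool) :
    ∑ q' ∈ Finset.Ico (q * B) ((q + 1) * B), trackedCells ρ N B m q' b cells ≤
      trackedCells ρ N B (m + 1) q b cells := by
  classical
  unfold trackedCells
  rw [← Finset.card_biUnion]
  · apply Finset.card_le_card
    intro i hi
    simp only [Finset.mem_biUnion, Finset.mem_filter, Finset.mem_univ, true_and] at hi ⊢
    obtain ⟨q', hq', j, hj, rfl⟩ := hi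
    refine ⟨j, hj, ?_⟩
    rw [pow_succ, ← Nat.div_div_eq_div_mul]
    exact div_eq_of_mem_Ico hq'
  · intro q₁ _ q₂ _ hne
    rw [Function.onFun, Finset.disjoint_left]
    intro i h1 h2
    simp only [Finset.mem_filter, Finset.mem_univ, true_and] at h1 h2
    obtain ⟨j, hj, rfl⟩ := h1
    obtain ⟨j', hj', rfl⟩ := h2
    rw [hj, Option.some.injEq] at hj'
    exact hne (by rw [hj'])

lemma trackedCells_le {g : ℕ} (ρ : Bool → ℕ) (N B m q : ℕ) (b : Bool)
    (cells : Fin g → List Bool) : trackedCells ρ N B m q b cells ≤ g := by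
  classical
  simpa [trackedCells] using Finset.card_filter_le (Finset.univ : Finset (Fin g))
    fun i => ∃ j, deepIndex ρ N (!b) (cells i) = some j ∧ j / B ^ m = q

lemma trackedCells_eq_zero_iff {g : ℕ} {ρ : Bool → ℕ} {N B m q : ℕ} {b : Bool}
    {cells : Fin g → List Bool} : trackedCells ρ N B m q b cells = 0 ↔
      ∀ i j, deepIndex ρ N (!b) (cells i) = some j → j / B ^ m ≠ q := by
  simp [trackedCells, Finset.filter_eq_empty_iff]

lemma answerVertex_injOn {ρ : Bool → ℕ} {N K K' : ℕ} (hK : K < N) (hK' : K' < N)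
    (h : answerVertex ρ N K = answerVertex ρ N K') : K = K' := by
  have := List.replicate_left_injective _ h
  omega

/-! ### Amortized lower bound over a block of parameters -/

namespace RandomizedAlgorithm

variable {g : ℕ}

/-- A lower bound on the total cost from a common configuration, over all parameters in a block.
Here `b` is the side visited last. -/
theorem sum_cost_lower_bound (A : RandomizedAlgorithm g) (ω : A.Seed) {ρ : Bool → ℕ} {B L R : ℕ}
    (hB : 2 ≤ B) (hg : 2 * g ≤ B) (hρ : ∀ b, R ≤ ρ b) (m k q : ℕ) (b : Bool)
    (c : VertexConfig g A.Control) (hq : (q + 1) * B ^ m ≤ B ^ L)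
    (hc : deepIndex ρ (B ^ L) (!b) c.node = none)
    (hout : ∀ K ∈ Finset.Ico (q * B ^ m) ((q + 1) * B ^ m),
      (A.vertexStep (hardTree ρ B L K) ω)^[k] (.inl c) = .inr (answerVertex ρ (B ^ L) K)) :
    (R * m * B ^ m - 2 * R * trackedCells ρ (B ^ L) B m q b c.cells * B ^ m
        - sideDistance R b c.node * B ^ m : ℤ) ≤
      ∑ K ∈ Finset.Ico (q * B ^ m) ((q + 1) * B ^ m),
        (A.cost (hardTree ρ B L K) ω k (.inl c) : ℤ) := by
  induction m generalizing k q b c with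
  | zero =>
    refine le_trans ?_ (Finset.sum_nonneg fun K _ => Int.natCast_nonneg _)
    have h1 := sideDistance_nonneg R b c.node
    have h2 : (0 : ℤ) ≤ 2 * R * trackedCells ρ (B ^ L) B 0 q b c.cells := by positivity
    simp only [pow_zero, mul_one, Nat.cast_zero, mul_zero]
    omega
  | succ m ihm =>
    have hB0 : 0 < B := by omega
    have hqB : q * B ≤ (q + 1) * B := Nat.mul_le_mul_right B (Nat.le_succ q)
    have e1 : q * B ^ (m + 1) = q * B * B ^ m := by ring
    have e2 : (q + 1) * B ^ (m + 1) = (q + 1) * B * B ^ m := by ring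
    -- Splitting the block gives a slightly weaker bound.
    have split : ∀ (k : ℕ) (b : Bool) (c : VertexConfig g A.Control),
        deepIndex ρ (B ^ L) (!b) c.node = none →
        (∀ K ∈ Finset.Ico (q * B ^ (m + 1)) ((q + 1) * B ^ (m + 1)),
          (A.vertexStep (hardTree ρ B L K) ω)^[k] (.inl c) = .inr (answerVertex ρ (B ^ L) K)) →
        (R * m * B ^ (m + 1) - 2 * R * trackedCells ρ (B ^ L) B (m + 1) q b c.cells * B ^ m
            - sideDistance R b c.node * B ^ (m + 1) : ℤ) ≤
          ∑ K ∈ Finset.Ico (q * B ^ (m + 1)) ((q + 1) * B ^ (m + 1)),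
            (A.cost (hardTree ρ B L K) ω k (.inl c) : ℤ) := by
      intro k b c hc hout
      rw [e1, e2] at hout ⊢
      rw [← sum_Ico_blocks _ _ hqB]
      have hsub : ∀ q' ∈ Finset.Ico (q * B) ((q + 1) * B),
          Finset.Ico (q' * B ^ m) ((q' + 1) * B ^ m) ⊆
            Finset.Ico (q * B * B ^ m) ((q + 1) * B * B ^ m) := by
        intro q' hq'
        rw [Finset.mem_Ico] at hq'
        exact Finset.Ico_subset_Ico (Nat.mul_le_mul_right _ hq'.1) (Nat.mul_le_mul_right _ hq'.2)
      have hle : ∀ q' ∈ Finset.Ico (q * B) ((q + 1) * B), (q' + 1) * B ^ m ≤ B ^ L := by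
        intro q' hq'
        rw [Finset.mem_Ico] at hq'
        exact (Nat.mul_le_mul_right _ hq'.2).trans (e2 ▸ hq)
      refine le_trans ?_ (Finset.sum_le_sum fun q' hq' =>
        ihm k q' b c (hle q' hq') hc fun K hK => hout K (hsub q' hq' hK))
      rw [Finset.sum_sub_distrib, Finset.sum_sub_distrib, Finset.sum_const, Finset.sum_const,
        ← Finset.sum_mul, ← Finset.mul_sum, Nat.card_Ico,
        show (q + 1) * B - q * B = B by rw [add_mul, one_mul, Nat.add_sub_cancel_left],
        nsmul_eq_mul, nsmul_eq_mul, ← Nat.cast_sum]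
      have ht : ((∑ q' ∈ Finset.Ico (q * B) ((q + 1) * B),
          trackedCells ρ (B ^ L) B m q' b c.cells : ℕ) : ℤ) ≤
            trackedCells ρ (B ^ L) B (m + 1) q b c.cells := by
        exact_mod_cast sum_trackedCells_le ρ (B ^ L) B m q b c.cells
      have hR : (0 : ℤ) ≤ 2 * R * B ^ m := by positivity
      have := mul_le_mul_of_nonneg_left ht hR
      rw [pow_succ]
      linarith
    have hcard : ((Finset.Ico (q * B ^ (m + 1)) ((q + 1) * B ^ (m + 1))).card : ℤ)
        = B ^ (m + 1) := by
      rw [Nat.card_Ico, show (q + 1) * B ^ (m + 1) - q * B ^ (m + 1) = B ^ (m + 1) by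
        rw [add_mul, one_mul, Nat.add_sub_cancel_left], Nat.cast_pow]
    have hpow : 2 ≤ B ^ (m + 1) :=
      hB.trans (Nat.le_self_pow (Nat.succ_ne_zero m) B)
    have hK₀ : q * B ^ (m + 1) ∈ Finset.Ico (q * B ^ (m + 1)) ((q + 1) * B ^ (m + 1)) := by
      rw [Finset.mem_Ico, add_mul]
      omega
    have hK₁ : q * B ^ (m + 1) + 1 ∈ Finset.Ico (q * B ^ (m + 1)) ((q + 1) * B ^ (m + 1)) := by
      rw [Finset.mem_Ico, add_mul]
      omega
    have hlt : ∀ K ∈ Finset.Ico (q * B ^ (m + 1)) ((q + 1) * B ^ (m + 1)), K < B ^ L :=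
      fun K hK => (Finset.mem_Ico.1 hK).2.trans_le hq
    induction k generalizing b c with
    | zero => simpa using hout _ hK₀
    | succ k ihk =>
      -- Without a tracked cell, all parameters of the block yield the same comparisons, so the runs
      -- move in lockstep until the agent reaches the other side.
      rcases Nat.eq_zero_or_pos (trackedCells ρ (B ^ L) B (m + 1) q b c.cells) with hs | hs
      · rw [hs]
        have hs' := trackedCells_eq_zero_iff.1 hs
        have hplace : ∀ a j, deepIndex ρ (B ^ L) (!b) (c.place a) = some j →
            j / B ^ (m + 1) ≠ q := by
          rintro (_ | i) j hj
          · rw [VertexConfig.place, hc] at hj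
            simp at hj
          · exact hs' i j hj
        set K₀ := q * B ^ (m + 1) with hK₀def
        have hcmp : ∀ K ∈ Finset.Ico K₀ ((q + 1) * B ^ (m + 1)),
            (c.toConfig (hardTree ρ B L K)).comparisons (hardTree ρ B L K) =
              (c.toConfig (hardTree ρ B L K₀)).comparisons (hardTree ρ B L K₀) := by
          intro K hK
          have hd := div_eq_of_mem_Ico hK
          have hd' := hd.trans (div_eq_of_mem_Ico hK₀).symm
          funext a a'
          simp only [Config.comparisons, VertexConfig.read_toConfig]
          exact cmp_congr
            (hardTree_val_lt_congr hB0 (hlt K hK) hd' (fun j hj => hd.symm ▸ hplace a j hj)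
              fun j hj => hd.symm ▸ hplace a' j hj)
            (hardTree_val_lt_congr hB0 (hlt K hK) hd' (fun j hj => hd.symm ▸ hplace a' j hj)
              fun j hj => hd.symm ▸ hplace a j hj)
        rcases hn : A.next ω c.control
            ((c.toConfig (hardTree ρ B L K₀)).comparisons (hardTree ρ B L K₀)) with
          ⟨d, copy, s⟩ | out
        · set c' : VertexConfig g A.Control :=
            ⟨d.apply c.node, fun i => c.place (copy i), s⟩ with hc'
          have hstep : ∀ K ∈ Finset.Ico K₀ ((q + 1) * B ^ (m + 1)),
              A.vertexStep (hardTree ρ B L K) ω (.inl c) = .inl c' := by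
            intro K hK
            rw [vertexStep, hcmp K hK, hn]
          have hout' : ∀ K ∈ Finset.Ico K₀ ((q + 1) * B ^ (m + 1)),
              (A.vertexStep (hardTree ρ B L K) ω)^[k] (.inl c') =
                .inr (answerVertex ρ (B ^ L) K) := by
            intro K hK
            rw [← hout K hK, Function.iterate_succ_apply, hstep K hK]
          have hsum : ∑ K ∈ Finset.Ico K₀ ((q + 1) * B ^ (m + 1)),
              (A.cost (hardTree ρ B L K) ω (k + 1) (.inl c) : ℤ) =
              B ^ (m + 1) * (if d.apply c.node = c.node then 0 else 1) +
                ∑ K ∈ Finset.Ico K₀ ((q + 1) * B ^ (m + 1)),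
                  (A.cost (hardTree ρ B L K) ω k (.inl c') : ℤ) := by
            rw [← hcard, ← nsmul_eq_mul, ← Finset.sum_const, ← Finset.sum_add_distrib]
            refine Finset.sum_congr rfl fun K hK => ?_
            rw [cost, hstep K hK, Nat.cast_add, edgeCount]
            split_ifs <;> simp
          rw [hsum]
          have hP : (0 : ℤ) < B ^ (m + 1) := by positivity
          rcases hdeep : deepIndex ρ (B ^ L) (!b) c'.node with _ | j
          -- Not yet across: cells are filled only from places outside the block, so none becomes
          -- tracked, and the move pays for the growth of `sideDistance`.
          · have ih := ihk b c' hdeep hout'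
            have hs0 : trackedCells ρ (B ^ L) B (m + 1) q b c'.cells = 0 :=
              trackedCells_eq_zero_iff.2 fun i j hj => hplace (copy i) j hj
            rw [hs0] at ih
            have := mul_le_mul_of_nonneg_right (sideDistance_apply_le R b d c.node) hP.le
            rw [show d.apply c.node = c'.node from rfl] at this ⊢
            linarith
          -- The agent has just crossed, so the roles of the sides are exchanged. The crossing is
          -- worth `2 * R` for each `K`; splitting loses at most `R` for each `K` because `2 * g ≤
          -- B`. The net gain `R` pays for one level.
          · have h := split k (!b) c' (deepIndex_not_eq_none hdeep) hout'
            have h1 := signedDepth_of_deepIndex hdeep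
            have h2 : (R : ℤ) ≤ ρ (!b) := by exact_mod_cast hρ (!b)
            have h3 := abs_le.1 (abs_signedDepth_apply_sub b d c.node)
            rw [show d.apply c.node = c'.node from rfl] at h3 ⊢
            rw [signedDepth_not] at h1
            have h4 : sideDistance R (!b) c'.node = 0 := by
              rw [sideDistance, signedDepth_not]
              omega
            have h5 : 2 * (R : ℤ) ≤
                (if c'.node = c.node then 0 else 1) + sideDistance R b c.node := by
              unfold sideDistance
              split_ifs at h3 ⊢ <;> omega
            have h6 : (2 * trackedCells ρ (B ^ L) B (m + 1) q (!b) c'.cells : ℤ) ≤ B := by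
              exact_mod_cast (Nat.mul_le_mul_left 2 (trackedCells_le ρ _ _ _ _ _ _)).trans hg
            have h7 : (0 : ℤ) ≤ R * B ^ m := by positivity
            have h8 := mul_le_mul_of_nonneg_left h6 h7
            have h9 := mul_le_mul_of_nonneg_right h5 hP.le
            rw [h4] at h
            have h10 : (R * B ^ m * B : ℤ) = R * B ^ (m + 1) := by ring
            push_cast
            linarith
        -- Halting now would output the same vertex for two different parameters.
        · exfalso
          have hfin : ∀ K ∈ Finset.Ico K₀ ((q + 1) * B ^ (m + 1)),
              c.place out = answerVertex ρ (B ^ L) K := by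
            intro K hK
            have := hout K hK
            rw [Function.iterate_succ_apply, vertexStep, hcmp K hK, hn,
              vertexStep_iterate_inr] at this
            exact Sum.inr.inj this
          have := answerVertex_injOn (hlt _ hK₀) (hlt _ hK₁)
            ((hfin _ hK₀).symm.trans (hfin _ hK₁))
          omega
      -- With `s ≥ 1` tracked cells, splitting dilutes their credit from `2 * R * s` to `2 * R * s /
      -- B` on average over `K`, which frees at least the `R` needed for one level.
      · refine le_trans ?_ (split (k + 1) b c hc hout)
        have h1 : (1 : ℤ) ≤ trackedCells ρ (B ^ L) B (m + 1) q b c.cells := by exact_mod_cast hs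
        generalize (trackedCells ρ (B ^ L) B (m + 1) q b c.cells : ℤ) = s at h1 ⊢
        have h2 : (2 : ℤ) ≤ B := by exact_mod_cast hB
        have h3 : (0 : ℤ) ≤ R * B ^ m := by positivity
        have h4 : (B : ℤ) ≤ 2 * s * B - 2 * s := by nlinarith
        have h5 := mul_le_mul_of_nonneg_left h4 h3
        rw [pow_succ]
        push_cast
        linarith

/-- The bound holds for almost every seed after summing over `K`, hence in expectation, and some `K`
attains the average. -/
lemma SolvesSelect.exists_le_expectedCost_hardTree {A : RandomizedAlgorithm g} {ρ : Bool → ℕ}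
    {B L R : ℕ} (hB : 2 ≤ B) (hg : 2 * g ≤ B) (hρ : ∀ b, R ≤ ρ b)
    (hA : A.SolvesSelect (ρ false + ρ true + B ^ (L + 1) + 2)) :
    ∃ K, ((R * L : ℕ) : ℝ≥0∞) ≤ A.expectedCost (hardTree ρ B (L + 1) K) := by
  set N := B ^ (L + 1) with hN
  have hNpos : 0 < N := by positivity
  have hae : ∀ᵐ ω ∂A.law, ((N * (R * L) : ℕ) : ℝ≥0∞) ≤
      ∑ K ∈ Finset.range N, A.travelCost (hardTree ρ B (L + 1) K) ω := by
    have hall : ∀ᵐ ω ∂A.law, ∀ K ∈ Finset.range N, ∃ k,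
        (A.vertexStep (hardTree ρ B (L + 1) K) ω)^[k] (.inl A.vertexInitial) =
          .inr (answerVertex ρ N K) := by
      rw [Finset.eventually_all]
      exact fun K hK => hA.ae_exists_vertex
        (hardTree_isNthSmallest (Nat.succ_pos L) (Finset.mem_range.1 hK))
    filter_upwards [hall] with ω hω
    choose! k hk using hω
    -- Halted runs stay halted, so one time serves all parameters.
    have hout : ∀ K ∈ Finset.range N,
        (A.vertexStep (hardTree ρ B (L + 1) K) ω)^[(Finset.range N).sup k]
          (.inl A.vertexInitial) = .inr (answerVertex ρ N K) := by
      intro K hK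
      rw [← Nat.sub_add_cancel (Finset.le_sup (f := k) hK), Function.iterate_add_apply, hk K hK,
        vertexStep_iterate_inr]
    have hnil : ∀ b, deepIndex ρ N b [] = none := fun b => by simp [deepIndex]
    have h := A.sum_cost_lower_bound ω hB hg hρ (L + 1) ((Finset.range N).sup k) 0 true
      A.vertexInitial (by simp) (hnil _) (by
        intro K hK
        exact hout K (by simpa [hN] using hK))
    have h0 : trackedCells ρ (B ^ (L + 1)) B (L + 1) 0 true A.vertexInitial.cells = 0 :=
      trackedCells_eq_zero_iff.2 fun i j hj => by
        rw [vertexInitial, hnil] at hj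
        simp at hj
    -- Starting at the root is half a crossing, which costs one of the `L + 1` levels.
    have hd : sideDistance R true A.vertexInitial.node = R := by
      simp [sideDistance, vertexInitial, signedDepth]
    rw [h0, hd, zero_mul, zero_add, one_mul, ← hN, Nat.Ico_zero_eq_range] at h
    have h' : N * (R * L) ≤ ∑ K ∈ Finset.range N,
        A.cost (hardTree ρ B (L + 1) K) ω ((Finset.range N).sup k) (.inl A.vertexInitial) := by
      zify
      refine le_trans (le_of_eq ?_) h
      rw [hN]
      push_cast
      ring
    refine le_trans (Nat.cast_le.2 h') ?_
    rw [Nat.cast_sum]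
    exact Finset.sum_le_sum fun K _ => A.cost_le_travelCost _ _ _
  have hsum : ∑ _K ∈ Finset.range N, ((R * L : ℕ) : ℝ≥0∞) ≤
      ∑ K ∈ Finset.range N, A.expectedCost (hardTree ρ B (L + 1) K) := by
    calc ∑ _K ∈ Finset.range N, ((R * L : ℕ) : ℝ≥0∞)
        = ∫⁻ _, ((N * (R * L) : ℕ) : ℝ≥0∞) ∂A.law := by simp
      _ ≤ ∫⁻ ω, ∑ K ∈ Finset.range N, A.travelCost (hardTree ρ B (L + 1) K) ω ∂A.law :=
        lintegral_mono_ae hae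
      _ = ∑ K ∈ Finset.range N, A.expectedCost (hardTree ρ B (L + 1) K) :=
        lintegral_finsetSum _ fun K _ => A.measurable_travelCost _
  by_contra! hcon
  exact absurd hsum (not_le.2 (ENNReal.sum_lt_sum_of_nonempty
    (Finset.nonempty_range_iff.2 hNpos.ne') fun K _ => hcon K))

end RandomizedAlgorithm

end ExplorableHeap

/-! ### Choice of parameters -/

theorem mainTheorem2 :
    ∃ C : ℝ, 0 < C ∧
      ∀ n g : ℕ, 1 ≤ n → 1 ≤ g →
        ∀ A : ExplorableHeap.RandomizedAlgorithm g, A.SolvesSelect n →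
          ∃ T : ExplorableHeap.HeapTree,
            ENNReal.ofReal (C * (n * Real.logb (g + 1) n)) ≤ A.expectedCost T := by
  -- The constant comes from `n ≤ 8 * R` and `log + 1 ≤ 4 * L` in the main case.
  refine ⟨1 / 32, by norm_num, fun n g hn hg A hA => ?_⟩
  have hlog : Real.logb (g + 1) n ≤ Nat.log (g + 1) n + 1 := by
    have h := Real.natFloor_logb_natCast (g + 1) n
    rw [← h]
    push_cast
    exact (Nat.lt_floor_add_one _).le
  have hn1 : (1 : ℝ) ≤ n := by exact_mod_cast hn
  have hlog' := mul_le_mul_of_nonneg_left hlog (by linarith : (0 : ℝ) ≤ n)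
  rcases hn.eq_or_lt with rfl | hn2
  · exact ⟨ExplorableHeap.pathTree 1, by simp⟩
  -- For a logarithm below 12 the target is at most `12 * n / 32`, which is below `n - 1` as `n ≥
  -- 2`.
  rcases Nat.lt_or_ge (Nat.log (g + 1) n) 12 with hl | hl
  · obtain ⟨n, rfl⟩ := Nat.exists_eq_add_of_le' hn
    refine ⟨_, le_trans ?_ hA.le_expectedCost_pathTree⟩
    rw [← ENNReal.ofReal_natCast]
    apply ENNReal.ofReal_le_ofReal
    have h1 : (Nat.log (g + 1) (n + 1) : ℝ) + 1 ≤ 12 := by exact_mod_cast hl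
    have h2 : (1 : ℝ) ≤ n := by exact_mod_cast Nat.lt_succ_iff.1 hn2
    have h3 := mul_le_mul_of_nonneg_left h1 (by positivity : (0 : ℝ) ≤ ((n + 1 : ℕ) : ℝ))
    push_cast at h3 hlog' ⊢
    linarith
  -- Each level uses up two factors `g + 1`; one further factor is kept to ensure `2 * N ≤ n`.
  · obtain ⟨L, hL⟩ : ∃ L, (Nat.log (g + 1) n - 1) / 2 = L + 1 := ⟨(Nat.log (g + 1) n - 1) / 2 - 1,
      by omega⟩
    set l := Nat.log (g + 1) n with hldef
    have hpow : (g + 1) ^ l ≤ n := Nat.pow_log_le_self _ (by omega)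
    set N := ((g + 1) ^ 2) ^ (L + 1) with hN
    have hN2 : 2 * N ≤ n := by
      calc 2 * N ≤ (g + 1) * N := Nat.mul_le_mul_right _ (by omega)
        _ = (g + 1) ^ (2 * (L + 1) + 1) := by rw [hN, ← pow_mul, pow_succ, mul_comm]
        _ ≤ (g + 1) ^ l := Nat.pow_le_pow_right (by omega) (by omega)
        _ ≤ n := hpow
    have hn12 : 2 ^ 12 ≤ n :=
      (Nat.pow_le_pow_left (by omega : 2 ≤ g + 1) 12).trans
        ((Nat.pow_le_pow_right (by omega) hl).trans hpow)
    -- The rank left after the `N + 2` of the deep part is shared between the two low paths.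
    set R := (n - N - 2) / 2 with hR
    have hn_eq : R + (n - N - 2 - R) + N + 2 = n := by omega
    obtain ⟨K, hK⟩ := ExplorableHeap.RandomizedAlgorithm.SolvesSelect.exists_le_expectedCost_hardTree
      (A := A) (ρ := fun b => if b then n - N - 2 - R else R) (B := (g + 1) ^ 2) (L := L) (R := R)
      (by nlinarith) (by nlinarith) (by intro b; cases b <;> simp; omega)
      (by simpa [← hN, hn_eq] using hA)
    refine ⟨_, le_trans ?_ hK⟩
    rw [← ENNReal.ofReal_natCast]
    apply ENNReal.ofReal_le_ofReal
    have h1 : (n : ℝ) ≤ 8 * R := by exact_mod_cast (by omega : n ≤ 8 * R)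
    have h2 : (l : ℝ) + 1 ≤ 4 * L := by exact_mod_cast (by omega : l + 1 ≤ 4 * L)
    have h3 : (n : ℝ) * (l + 1) ≤ 8 * R * (4 * L) := by
      apply mul_le_mul h1 h2 <;> positivity
    push_cast
    linarith
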